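/- Let $(\Omega,\mathcal F,\mathbb P)$ be a probability space and $\mathcal G\subseteq\mathcal F$ a $\sigma$-algebra. Let $L_{\mathcal F}\subseteq L^0(\Omega,\mathcal F,\mathbb P)$ and $L_{\mathcal G}\subseteq L^0(\Omega,\mathcal G,\mathbb P)$ be vector lattices (linear subspaces closed under $\vee$ and $\wedge$, for the $\mathbb P$-a.s. order) such that $X\mathbf 1_A\in L_{\mathcal F}$ for all $X\in L_{\mathcal F}$, $A\in\mathcal F$, and $Y\mathbf 1_A\in L_{\mathcal G}$ for all $Y\in L_{\mathcal G}$, $A\in\mathcal G$. Let $L_{\mathcal F}^*$ be the order continuous dual of $L_{\mathcal F}$, i.e. the space of linear functionals $\varphi:L_{\mathcal F}\to\mathbb R$ with $\varphi(X_\alpha)\to\varphi(X)$ for every net $X_\alpha$ that order converges to $X$ in $L_{\mathcal F}$. Assume that $L_{\mathcal F}^*\subseteq L^1(\Omega,\mathcal F,\mathbb P)$, in the sense that every $\varphi\in L_{\mathcal F}^*$ has the form $\varphi(X)=E_{\mathbb P}[ZX]$ for some $Z\in L^1$ with $ZX\in L^1$ for all $X\in L_{\mathcal F}$, and that $L_{\mathcal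 F}^*$ separates the points of $L_{\mathcal F}$. Let $\pi:L_{\mathcal F}\to L_{\mathcal G}$ satisfy (MON) $X\le Y\Rightarrow\pi(X)\le\pi(Y)$; (QCO) $\pi(\Lambda X+(1-\Lambda)Y)\le\pi(X)\vee\pi(Y)$ for all $X,Y\in L_{\mathcal F}$ and all $\mathcal G$-measurable $\Lambda$ with $0\le\Lambda\le1$ and $\Lambda X+(1-\Lambda)Y\in L_{\mathcal F}$; (REG) $\pi(X\mathbf 1_A+Y\mathbf 1_{A^c})=\pi(X)\mathbf 1_A+\pi(Y)\mathbf 1_{A^c}$ for all $X,Y\in L_{\mathcal F}$, $A\in\mathcal G$; (LSC) for every $Y\in L_{\mathcal G}$ the set $\{X\in L_{\mathcal F}\mid\pi(X)\le Y\}$ is closed in the weak topology $\sigma(L_{\mathcal F},L_{\mathcal F}^*)$. Let $L_{\mathcal F}^*\cap\mathcal P$ be the set of probability measures $Q\ll\mathbb P$ such that $X\mapsto E_{\mathbb P}[\frac{dQ}{d\mathbb P}X]$ is well defined on $L_{\mathcal F}$ (i.e. $\frac{dQ}{d\mathbb P}X\in L^1$ for all $X\in L_{\mathcal F}$) and belongs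 to $L_{\mathcal F}^*$. For $X\in L_{\mathcal F}$ and $Q\in L_{\mathcal F}^*\cap\mathcal P$ let $$K(X,Q):=\operatorname{ess\,inf}\{\pi(\xi)\mid \xi\in L_{\mathcal F},\ E_Q[\xi\mid\mathcal G]\ge E_Q[X\mid\mathcal G]\ Q\text{-a.s.}\},$$ a random variable with values in $[-\infty,\infty)$; essential infima and suprema are taken with respect to $\mathbb P$. Then for every $X\in L_{\mathcal F}$ $$\pi(X)=\operatorname*{ess\,sup}_{Q\in L_{\mathcal F}^*\cap\mathcal P}K(X,Q).$$ -/

import Mathlib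

/-!
Every `K(X, Q)` is at most `π X`, since `ξ = X` competes in the essential infimum.

Conversely let `π ξ₀ ≤ Y` and `π X ≰ Y`. Hahn–Banach separates `X` from the closed convex set
`{π ≤ Y}` by a functional `ξ ↦ E[Z ξ]`, and (MON) makes it positive, so `0 ≤ Z`. By (REG) the set
`{π ≤ Y}` is stable under pasting along events of `G`; exhausting the events on which
`E[Z (X - ξ) | G] ≤ 0` for some `ξ ∈ {π ≤ Y}` therefore leaves a non-null `D ∈ G` on which
`E[Z (X - ξ) | G] > 0` for all these `ξ` at once. Let `Q` have density proportional to `Z 𝟏_D`.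
If `E_Q[ξ | G] ≥ E_Q[X | G]`, then `π ξ ≤ Y` can hold on no non-null part of `D`, so
`K(X, Q) ≥ Y` on `D`.

Applied to `Y` pasted with `π X`, this bounds the essential supremum from below by every `Y` with
`π ξ ≤ Y < π X`, on the event where these inequalities hold, and `Y ↑ π X` gives the claim on
`{π ξ < π X}`. Where no `ξ` satisfies `π ξ < π X`, every `Q` has `K(X, Q) = π X`.
-/

open MeasureTheory Filter Topology

universe u

namespace QuasiconvexDual

/-! `Ω →ₘ[P] ℝ` is the space `L⁰(Ω, F, P)` of (classes of) a.s. finite random variables with its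
a.s. order; `Ω →ₘ[P] EReal` is the space of extended-valued random variables. -/

section EssentialInfimum

variable {Ω : Type u} [MeasurableSpace Ω] (P : Measure Ω)

/-- The a.s. order on extended-valued random variables is order complete from below:
every family has an essential infimum, i.e. a greatest lower bound for the a.s. order. -/
theorem exists_essInf [IsFiniteMeasure P] (S : Set (Ω →ₘ[P] EReal)) :
    ∃ a : Ω →ₘ[P] EReal, IsGLB S a := by
  rcases S.eq_empty_or_nonempty with rfl | hne
  · refine ⟨AEEqFun.const Ω ⊤, ?_⟩
    refine ⟨by simp, fun b _ => ?_⟩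
    rw [← AEEqFun.coeFn_le]
    filter_upwards [AEEqFun.coeFn_const (μ := P) Ω (⊤ : EReal)] with ω h
    rw [h]
    exact le_top
  have : Nonempty S := hne.to_subtype
  let g : EReal ≃o Set.Icc (0 : ℝ) 1 :=
    EReal.expOrderIso.trans ENNReal.orderIsoUnitIntervalBirational
  have hg : Measurable fun x : EReal => (g x : ℝ) :=
    (continuous_subtype_val.comp g.continuous).measurable
  have hmono : ∀ {x y : EReal}, x ≤ y → (g x : ℝ) ≤ g y := fun h => g.monotone h
  have hinj : ∀ {x y : EReal}, (g x : ℝ) = g y → x = y := fun h => g.injective (Subtype.ext h)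
  let F : (ℕ → S) → Ω → EReal := fun s ω => ⨅ n, (s n : Ω →ₘ[P] EReal) ω
  have hFm : ∀ s, Measurable (F s) := fun s =>
    Measurable.iInf fun n => (s n : Ω →ₘ[P] EReal).measurable
  have hint : ∀ s, Integrable (fun ω => (g (F s ω) : ℝ)) P := fun s =>
    Integrable.of_bound (hg.comp (hFm s)).aestronglyMeasurable 1
      (Eventually.of_forall fun ω => by
        rw [Real.norm_eq_abs, abs_le]
        have h := (g (F s ω)).2
        exact ⟨by linarith [h.1], h.2⟩)
  let I : (ℕ → S) → ℝ := fun s => ∫ ω, (g (F s ω) : ℝ) ∂P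
  have hbdd : BddBelow (Set.range I) := ⟨0, by
    rintro _ ⟨s, rfl⟩
    exact integral_nonneg fun ω => (g (F s ω)).2.1⟩
  have hmin : ∃ s, ∀ t, I s ≤ I t := by
    have hk : ∀ k : ℕ, ∃ s, I s < (⨅ t, I t) + 1 / ((k : ℝ) + 1) := fun k =>
      exists_lt_of_ciInf_lt (lt_add_of_pos_right _ (by positivity))
    choose s hs using hk
    refine ⟨fun n => s n.unpair.1 n.unpair.2, fun t => ?_⟩
    have hle : ∀ k, I (fun n => s n.unpair.1 n.unpair.2) ≤ I (s k) := fun k =>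
      integral_mono (hint _) (hint _) fun ω => hmono (le_iInf fun m => by
        refine (iInf_le _ (Nat.pair k m)).trans ?_
        simp)
    refine le_trans ?_ (ciInf_le hbdd t)
    refine ge_of_tendsto' (x := atTop)
      (f := fun k : ℕ => (⨅ t, I t) + 1 / ((k : ℝ) + 1)) ?_ fun k => (hle k).trans (hs k).le
    simpa using tendsto_const_nhds.add (tendsto_one_div_add_atTop_nhds_zero_nat (𝕜 := ℝ))
  obtain ⟨s, hs⟩ := hmin
  refine ⟨AEEqFun.mk (F s) (hFm s).aestronglyMeasurable, ?_, ?_⟩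
  · intro t ht
    let s' : ℕ → S := fun n => Nat.casesOn n ⟨t, ht⟩ s
    have hF : ∀ ω, F s' ω ≤ F s ω := fun ω => le_iInf fun n => iInf_le _ (n + 1)
    have hF0 : ∀ ω, F s' ω ≤ t ω := fun ω => by
      have h : F s' ω ≤ (s' 0 : Ω →ₘ[P] EReal) ω := iInf_le _ 0
      exact h
    have heq : (fun ω => (g (F s' ω) : ℝ)) =ᵐ[P] fun ω => (g (F s ω) : ℝ) :=
      (integral_eq_iff_of_ae_le (hint _) (hint _)
        (Eventually.of_forall fun ω => hmono (hF ω))).1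
        (le_antisymm (integral_mono (hint _) (hint _) fun ω => hmono (hF ω)) (hs s'))
    rw [← AEEqFun.coeFn_le]
    filter_upwards [AEEqFun.coeFn_mk (F s) (hFm s).aestronglyMeasurable, heq] with ω h1 h2
    rw [h1, ← hinj h2]
    exact hF0 ω
  · intro b hb
    rw [← AEEqFun.coeFn_le]
    have hall : ∀ᵐ ω ∂P, ∀ n, b ω ≤ (s n : Ω →ₘ[P] EReal) ω :=
      ae_all_iff.2 fun n => AEEqFun.coeFn_le.2 (hb (s n).2)
    filter_upwards [AEEqFun.coeFn_mk (F s) (hFm s).aestronglyMeasurable, hall] with ω h1 h2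
    rw [h1]
    exact le_iInf h2

/-- The essential infimum of a family of extended-valued random variables. -/
noncomputable def essInfFamily [IsFiniteMeasure P] (S : Set (Ω →ₘ[P] EReal)) :
    Ω →ₘ[P] EReal :=
  (exists_essInf P S).choose

theorem isGLB_essInfFamily [IsFiniteMeasure P] (S : Set (Ω →ₘ[P] EReal)) :
    IsGLB S (essInfFamily P S) :=
  (exists_essInf P S).choose_spec

/-- A finite random variable regarded as an extended-valued one. -/
noncomputable def toExt {P : Measure Ω} (X : Ω →ₘ[P] ℝ) : Ω →ₘ[P] EReal :=
  AEEqFun.comp (fun x : ℝ => (x : EReal)) continuous_coe_real_ereal X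

end EssentialInfimum

section Spaces

variable {Ω : Type u} (G : MeasurableSpace Ω) {mΩ : MeasurableSpace Ω} {P : Measure Ω}

/-- `X 𝟏_A` as a random variable. -/
noncomputable def restr (X : Ω →ₘ[P] ℝ) (A : Set Ω) (hA : MeasurableSet A) : Ω →ₘ[P] ℝ :=
  AEEqFun.mk (A.indicator X) (X.aestronglyMeasurable.indicator hA)

/-- The vector space `L` is closed under the lattice operations of `L⁰`. -/
def IsVectorLattice (L : Submodule ℝ (Ω →ₘ[P] ℝ)) : Prop :=
  ∀ X ∈ L, ∀ Y ∈ L, X ⊔ Y ∈ L ∧ X ⊓ Y ∈ L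

/-- Property `1_G` for a σ-algebra `G ⊆ F`: `X 𝟏_A ∈ L` for all `X ∈ L`, `A ∈ G`. -/
def HasIndicators (hG : G ≤ mΩ) (L : Submodule ℝ (Ω →ₘ[P] ℝ)) : Prop :=
  ∀ X ∈ L, ∀ (A : Set Ω) (hA : MeasurableSet[G] A), restr X A (hG A hA) ∈ L

/-- Order convergence in `L` of a net: `|x i - a| ≤ y i` for some net `y ↓ 0` in `L`.
The infimum of `y` is taken in `L`. -/
def OrderTendsto (L : Submodule ℝ (Ω →ₘ[P] ℝ)) {ι : Type u} [Preorder ι]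
    (x : ι → L) (a : L) : Prop :=
  ∃ y : ι → L, Antitone y ∧ IsGLB (Set.range y) 0 ∧
    ∀ i, |(x i : Ω →ₘ[P] ℝ) - (a : Ω →ₘ[P] ℝ)| ≤ (y i : Ω →ₘ[P] ℝ)

/-- The order continuous dual of `L`: linear functionals that map order convergent nets to
convergent nets. (Index sets in the universe of `Ω` suffice, since the pairs of elements of `L`
live there.) -/
def orderDual (L : Submodule ℝ (Ω →ₘ[P] ℝ)) : Submodule ℝ (L →ₗ[ℝ] ℝ) where
  carrier := {φ | ∀ (ι : Type u) [Preorder ι] [IsDirectedOrder ι] [Nonempty ι]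
    (x : ι → L) (a : L), OrderTendsto L x a → Tendsto (fun i => φ (x i)) atTop (𝓝 (φ a))}
  add_mem' hφ hψ ι _ _ _ x a h := by
    simpa using (hφ ι x a h).add (hψ ι x a h)
  zero_mem' ι _ _ _ x a _ := by simp
  smul_mem' c φ hφ ι _ _ _ x a h := by
    simpa using (hφ ι x a h).const_mul c

/-- `Z ∈ L¹` represents the functional `φ` on `L`: `φ X = E[Z X]` for all `X ∈ L`. -/
def Represents {L : Submodule ℝ (Ω →ₘ[P] ℝ)} (Z : Ω → ℝ) (φ : L →ₗ[ℝ] ℝ) : Prop :=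
  Integrable Z P ∧ ∀ X : L, Integrable (fun ω => Z ω * (X : Ω →ₘ[P] ℝ) ω) P ∧
    φ X = ∫ ω, Z ω * (X : Ω →ₘ[P] ℝ) ω ∂P

/-- The order continuous dual of `L` is contained in `L¹`. -/
def DualInL1 (L : Submodule ℝ (Ω →ₘ[P] ℝ)) : Prop :=
  ∀ φ ∈ orderDual L, ∃ Z : Ω → ℝ, Represents Z φ

/-- The order continuous dual of `L` separates the points of `L`. -/
def DualSeparates (L : Submodule ℝ (Ω →ₘ[P] ℝ)) : Prop :=
  ∀ X : L, X ≠ 0 → ∃ φ ∈ orderDual L, φ X ≠ 0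

/-- The weak topology `σ(L, L*)`: the coarsest topology for which all elements of the order
continuous dual are continuous. -/
@[reducible]
def weakTopology (L : Submodule ℝ (Ω →ₘ[P] ℝ)) : TopologicalSpace L :=
  TopologicalSpace.induced (fun X (φ : orderDual L) => (φ : L →ₗ[ℝ] ℝ) X) inferInstance

/-- `L* ∩ 𝒫`: the probability measures `Q ≪ P` whose density `dQ/dP` represents an element of the
order continuous dual of `L`. -/
def dualProbabilities (L : Submodule ℝ (Ω →ₘ[P] ℝ)) : Set (Measure Ω) :=
  {Q | IsProbabilityMeasure Q ∧ Q ≪ P ∧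
    ∃ φ ∈ orderDual L, Represents (fun ω => (Q.rnDeriv P ω).toReal) φ}

end Spaces

section Maps

variable {Ω : Type u} (G : MeasurableSpace Ω) {mΩ : MeasurableSpace Ω} {P : Measure Ω}
  {LF LG : Submodule ℝ (Ω →ₘ[P] ℝ)}

/-- (QCO): `π (Λ X + (1 - Λ) Y) ≤ π X ∨ π Y` for every `G`-measurable `Λ` with `0 ≤ Λ ≤ 1`,
whenever the combination `W = Λ X + (1 - Λ) Y` lies in the domain of `π`. -/
def CondQuasiconvex (π : LF → LG) : Prop :=
  ∀ (X Y W : LF) (Λ : Ω →ₘ[P] ℝ), AEStronglyMeasurable[G] Λ P → 0 ≤ Λ → Λ ≤ 1 →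
    (W : Ω →ₘ[P] ℝ) = Λ * (X : Ω →ₘ[P] ℝ) + (1 - Λ) * (Y : Ω →ₘ[P] ℝ) →
    (π W : Ω →ₘ[P] ℝ) ≤ (π X : Ω →ₘ[P] ℝ) ⊔ (π Y : Ω →ₘ[P] ℝ)

/-- (REG): `π (X 𝟏_A + Y 𝟏_{Aᶜ}) = π X 𝟏_A + π Y 𝟏_{Aᶜ}` for every `A ∈ G`. -/
def Regular (hG : G ≤ mΩ) (π : LF → LG) : Prop :=
  ∀ (X Y W : LF) (A : Set Ω) (hA : MeasurableSet[G] A),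
    (W : Ω →ₘ[P] ℝ) = restr (X : Ω →ₘ[P] ℝ) A (hG A hA)
      + restr (Y : Ω →ₘ[P] ℝ) Aᶜ (hG A hA).compl →
    (π W : Ω →ₘ[P] ℝ) = restr (π X : Ω →ₘ[P] ℝ) A (hG A hA)
      + restr (π Y : Ω →ₘ[P] ℝ) Aᶜ (hG A hA).compl

/-- (LSC) for `σ(LF, LF*)`: all lower level sets `{X | π X ≤ Y}`, `Y ∈ LG`, are closed. -/
def WeaklyLSC (π : LF → LG) : Prop :=
  ∀ Y : LG, IsClosed[weakTopology LF] {X : LF | π X ≤ Y}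

/-- `K(X, Q)`, the essential infimum of `π ξ` over all `ξ ∈ LF` with
`E_Q[ξ|G] ≥ E_Q[X|G]` `Q`-almost surely. -/
noncomputable def K [IsFiniteMeasure P] (π : LF → LG) (X : LF)
    (Q : Measure Ω) : Ω →ₘ[P] EReal :=
  essInfFamily P {Y | ∃ ξ : LF,
    Q[((X : Ω →ₘ[P] ℝ) : Ω → ℝ) | G] ≤ᵐ[Q] Q[((ξ : Ω →ₘ[P] ℝ) : Ω → ℝ) | G] ∧
    Y = toExt (π ξ : Ω →ₘ[P] ℝ)}

end Maps

end QuasiconvexDual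

namespace QuasiconvexDual

section Exhaustion

variable {Ω : Type u} {G mΩ : MeasurableSpace Ω} {P : Measure Ω}

theorem exists_measurableSet_ae_mem_iff_le {f g : Ω → ℝ} (hf : AEStronglyMeasurable[G] f P)
    (hg : AEStronglyMeasurable[G] g P) :
    ∃ E, MeasurableSet[G] E ∧ ∀ᵐ ω ∂P, ω ∈ E ↔ f ω ≤ g ω := by
  refine ⟨{ω | hf.mk f ω ≤ hg.mk g ω},
    hf.stronglyMeasurable_mk.measurableSet_le hg.stronglyMeasurable_mk, ?_⟩
  filter_upwards [hf.ae_eq_mk, hg.ae_eq_mk] with ω hfω hgω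
  rw [← hfω, ← hgω]

variable [IsFiniteMeasure P]

theorem exists_monotone_exhausting {𝒟 : Set (Set Ω)} (hne : 𝒟.Nonempty)
    (hunion : ∀ D ∈ 𝒟, ∀ E ∈ 𝒟, D ∪ E ∈ 𝒟) (hmeas : ∀ D ∈ 𝒟, MeasurableSet D) :
    ∃ s : ℕ → Set Ω, Monotone s ∧ (∀ n, s n ∈ 𝒟) ∧ ∀ E ∈ 𝒟, P (E \ ⋃ n, s n) = 0 := by
  obtain ⟨v, -, hvt, hv⟩ := exists_seq_tendsto_sSup (hne.image P) (OrderTop.bddAbove _)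
  choose t ht htv using hv
  have hs : ∀ n, Set.accumulate t n ∈ 𝒟 := by
    intro n
    induction n with
    | zero => simpa using ht 0
    | succ n ih =>
      rw [Set.accumulate_succ]
      exact hunion _ ih _ (ht _)
  refine ⟨Set.accumulate t, Set.monotone_accumulate, hs, fun E hE => ?_⟩
  have hsup_le : sSup (P '' 𝒟) ≤ P (⋃ n, Set.accumulate t n) := by
    refine le_of_tendsto' hvt fun n => ?_
    rw [← htv n]
    exact measure_mono
      ((Set.subset_accumulate (s := t) (x := n)).trans (Set.subset_iUnion _ n))
  have hle_sup : P (E ∪ ⋃ n, Set.accumulate t n) ≤ sSup (P '' 𝒟) := by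
    rw [Set.union_iUnion]
    refine le_of_tendsto' (tendsto_measure_iUnion_atTop fun i j hij => ?_) fun n =>
      le_sSup ⟨_, hunion _ hE _ (hs n), rfl⟩
    exact Set.union_subset_union_right _ (Set.monotone_accumulate hij)
  rw [← Set.union_sdiff_right, measure_sdiff Set.subset_union_right
    (MeasurableSet.iUnion fun n => hmeas _ (hs n)).nullMeasurableSet (measure_ne_top _ _)]
  exact tsub_eq_zero_of_le (hle_sup.trans hsup_le)

theorem ae_mem_imp_of_forall_exists_subset (hG : G ≤ mΩ) {p : Ω → Prop} {A : Set Ω}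
    (hA : MeasurableSet[G] A)
    (h : ∀ B ⊆ A, MeasurableSet[G] B → P B ≠ 0 →
      ∃ D ⊆ B, MeasurableSet[G] D ∧ P D ≠ 0 ∧ ∀ᵐ ω ∂P, ω ∈ D → p ω) :
    ∀ᵐ ω ∂P, ω ∈ A → p ω := by
  obtain ⟨s, -, hs, hmax⟩ := exists_monotone_exhausting (P := P)
    (𝒟 := {D | MeasurableSet[G] D ∧ ∀ᵐ ω ∂P, ω ∈ D → p ω}) ⟨∅, by simp⟩
    (fun D hD E hE => ⟨hD.1.union hE.1, by
      filter_upwards [hD.2, hE.2] with ω hωD hωE hω using hω.elim hωD hωE⟩)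
    fun D hD => hG _ hD.1
  have hnull : P (A \ ⋃ n, s n) = 0 := by
    by_contra h0
    obtain ⟨D, hDA, hD, hD0, hDp⟩ :=
      h _ Set.sdiff_subset (hA.diff (MeasurableSet.iUnion fun n => (hs n).1)) h0
    refine hD0 (measure_mono_null (Set.subset_sdiff.2 ⟨subset_rfl, ?_⟩) (hmax D ⟨hD, hDp⟩))
    exact Set.disjoint_left.2 fun ω hω => (hDA hω).2
  filter_upwards [measure_eq_zero_iff_ae_notMem.1 hnull, ae_all_iff.2 fun n => (hs n).2]
    with ω hω hp hωA
  obtain ⟨n, hn⟩ := Set.mem_iUnion.1 (not_not.1 fun hU => hω ⟨hωA, hU⟩)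
  exact hp n hn

end Exhaustion

section CondExp

variable {Ω : Type u} {G mΩ : MeasurableSpace Ω} {P : Measure Ω}

theorem condExp_indicator_add_indicator_compl {f g : Ω → ℝ} (hf : Integrable f P)
    (hg : Integrable g P) (hG : G ≤ mΩ) {E : Set Ω} (hE : MeasurableSet[G] E) :
    P[E.indicator f + Eᶜ.indicator g | G] =ᵐ[P]
      E.indicator P[f | G] + Eᶜ.indicator P[g | G] :=
  (condExp_add (hf.indicator (hG _ hE)) (hg.indicator (hG _ hE.compl)) G).trans
    ((condExp_indicator hf hE).add (condExp_indicator hg hE.compl))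

theorem setIntegral_le_of_condExp_le (hG : G ≤ mΩ) [SigmaFinite (P.trim hG)] {f g : Ω → ℝ}
    (hf : Integrable f P) (hg : Integrable g P) (hfg : P[f | G] ≤ᵐ[P] P[g | G]) {E : Set Ω}
    (hE : MeasurableSet[G] E) : ∫ ω in E, f ω ∂P ≤ ∫ ω in E, g ω ∂P := by
  rw [← setIntegral_condExp hG hf hE, ← setIntegral_condExp hG hg hE]
  exact setIntegral_mono_ae integrable_condExp.integrableOn integrable_condExp.integrableOn hfg

theorem measure_eq_zero_of_condExp_pos_of_setIntegral_nonpos (hG : G ≤ mΩ)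
    [SigmaFinite (P.trim hG)] {f : Ω → ℝ} (hf : Integrable f P) {E : Set Ω}
    (hE : MeasurableSet[G] E) (hpos : ∀ᵐ ω ∂P, ω ∈ E → 0 < P[f | G] ω)
    (hle : ∫ ω in E, f ω ∂P ≤ 0) : P E = 0 := by
  rw [← setIntegral_condExp hG hf hE] at hle
  by_contra hE0
  refine hle.not_gt ((setIntegral_pos_iff_support_of_nonneg_ae ?_
    integrable_condExp.integrableOn).2 ((pos_iff_ne_zero.2 hE0).trans_le (measure_mono_ae ?_)))
  · refine (ae_restrict_iff' (hG _ hE)).2 ?_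
    filter_upwards [hpos] with ω h hω using (h hω).le
  · filter_upwards [hpos] with ω h hω using ⟨(h hω).ne', hω⟩

theorem integral_indicator_pos_of_condExp_mul_pos (hG : G ≤ mΩ)
    [SigmaFinite (P.trim hG)] {f g : Ω → ℝ} (hf : Integrable f P) (hf_nonneg : 0 ≤ f)
    (hfg : Integrable (fun ω => f ω * g ω) P) {D : Set Ω} (hD : MeasurableSet[G] D)
    (hD0 : P D ≠ 0) (hpos : ∀ᵐ ω ∂P, ω ∈ D → 0 < P[fun ω => f ω * g ω | G] ω) :
    0 < ∫ ω, D.indicator f ω ∂P := by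
  have hDf_nonneg : 0 ≤ D.indicator f := Set.indicator_nonneg fun ω _ => hf_nonneg ω
  refine (integral_nonneg hDf_nonneg).lt_of_ne fun h0 => hD0 ?_
  have hDf := (integral_eq_zero_iff_of_nonneg hDf_nonneg (hf.indicator (hG _ hD))).1 h0.symm
  refine measure_eq_zero_of_condExp_pos_of_setIntegral_nonpos hG hfg hD hpos ?_
  refine (setIntegral_congr_ae (g := 0) (hG _ hD) ?_).trans_le (by simp)
  filter_upwards [hDf] with ω hω hωD
  rw [Set.indicator_of_mem hωD] at hω
  simp [hω]

variable {ι : Type*} [Nonempty ι] {h : ι → Ω → ℝ} {ε : ℝ}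

/- On `s n` the integral of `h i` is nonpositive, so pasting `h i` on `s n` with a fixed `h j`
leaves an integral of at most `∫ ω in (s n)ᶜ, h j ω ∂P`, which tends to `0`. -/
theorem measure_compl_iUnion_ne_zero_of_condExp_nonpos (hG : G ≤ mΩ)
    [SigmaFinite (P.trim hG)] (hint : ∀ i, Integrable (h i) P)
    (hpaste : ∀ E, MeasurableSet[G] E → ∀ i j, ∃ k,
      h k =ᵐ[P] E.indicator (h i) + Eᶜ.indicator (h j))
    (hε : 0 < ε) (hle : ∀ i, ε ≤ ∫ ω, h i ω ∂P) {s : ℕ → Set Ω} (hmono : Monotone s)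
    (hs : ∀ n, MeasurableSet[G] (s n))
    (hnonpos : ∀ n, ∃ i, ∀ᵐ ω ∂P, ω ∈ s n → P[h i | G] ω ≤ 0) : P (⋃ n, s n)ᶜ ≠ 0 := by
  intro hnull
  obtain ⟨j⟩ := ‹Nonempty ι›
  have hlim : Tendsto (fun n => ∫ ω in (s n)ᶜ, h j ω ∂P) atTop (𝓝 0) := by
    have hanti := tendsto_setIntegral_of_antitone (μ := P) (s := fun n => (s n)ᶜ) (f := h j)
      (fun n => (hG _ (hs n)).compl) (fun m n hmn => Set.compl_subset_compl.2 (hmono hmn))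
      ⟨0, (hint j).integrableOn⟩
    rwa [← Set.compl_iUnion, setIntegral_measure_zero _ hnull] at hanti
  refine (ge_of_tendsto' hlim fun n => ?_).not_gt hε
  obtain ⟨i, hi⟩ := hnonpos n
  obtain ⟨k, hk⟩ := hpaste _ (hs n) i j
  have hsn := hG _ (hs n)
  have hi_nonpos : ∫ ω in s n, h i ω ∂P ≤ 0 := by
    rw [← setIntegral_condExp hG (hint i) (hs n)]
    exact integral_nonpos_of_ae ((ae_restrict_iff' hsn).2 hi)
  calc ε ≤ ∫ ω, h k ω ∂P := hle k
    _ = ∫ ω in s n, h i ω ∂P + ∫ ω in (s n)ᶜ, h j ω ∂P := by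
      rw [integral_congr_ae hk, integral_add' ((hint i).indicator hsn)
        ((hint j).indicator hsn.compl), integral_indicator hsn, integral_indicator hsn.compl]
    _ ≤ ∫ ω in (s n)ᶜ, h j ω ∂P := add_le_of_nonpos_left hi_nonpos

theorem exists_measurableSet_forall_condExp_pos [IsFiniteMeasure P] (hG : G ≤ mΩ)
    (hint : ∀ i, Integrable (h i) P)
    (hpaste : ∀ E, MeasurableSet[G] E → ∀ i j, ∃ k,
      h k =ᵐ[P] E.indicator (h i) + Eᶜ.indicator (h j))
    (hε : 0 < ε) (hle : ∀ i, ε ≤ ∫ ω, h i ω ∂P) :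
    ∃ D, MeasurableSet[G] D ∧ P D ≠ 0 ∧ ∀ i, ∀ᵐ ω ∂P, ω ∈ D → 0 < P[h i | G] ω := by
  let 𝒟 : Set (Set Ω) := {E | MeasurableSet[G] E ∧ ∃ i, ∀ᵐ ω ∂P, ω ∈ E → P[h i | G] ω ≤ 0}
  have hunion : ∀ E ∈ 𝒟, ∀ F ∈ 𝒟, E ∪ F ∈ 𝒟 := by
    rintro E ⟨hE, i, hi⟩ F ⟨hF, j, hj⟩
    obtain ⟨k, hk⟩ := hpaste E hE i j
    refine ⟨hE.union hF, k, ?_⟩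
    filter_upwards [hi, hj, condExp_congr_ae hk,
      condExp_indicator_add_indicator_compl (hint i) (hint j) hG hE] with ω hiω hjω hkω hEω hω
    rw [hkω, hEω]
    by_cases hωE : ω ∈ E
    · simpa [hωE] using hiω hωE
    · simpa [hωE] using hjω (hω.resolve_left hωE)
  obtain ⟨s, hmono, hs, hmax⟩ :=
    exists_monotone_exhausting (P := P) (𝒟 := 𝒟) ⟨∅, by simp [𝒟]⟩ hunion fun E hE => hG _ hE.1
  have hsm : ∀ n, MeasurableSet[G] (s n) := fun n => (hs n).1
  have hU : MeasurableSet[G] (⋃ n, s n)ᶜ := (MeasurableSet.iUnion hsm).compl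
  refine ⟨_, hU, measure_compl_iUnion_ne_zero_of_condExp_nonpos hG hint hpaste hε hle hmono hsm
    fun n => (hs n).2, fun i => ?_⟩
  have hE : MeasurableSet[G] {ω | P[h i | G] ω ≤ 0} :=
    stronglyMeasurable_condExp.measurableSet_le stronglyMeasurable_const
  have hnull := hmax _ ⟨hE, i, Eventually.of_forall fun ω hω => hω⟩
  filter_upwards [measure_eq_zero_iff_ae_notMem.1 hnull] with ω hω hωU
  exact not_le.1 fun hle => hω ⟨hle, hωU⟩

end CondExp

section Functionals

variable {Ω : Type u} {G mΩ : MeasurableSpace Ω} {hG : G ≤ mΩ} {P : Measure Ω}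
  {L : Submodule ℝ (Ω →ₘ[P] ℝ)}

/-- Elements of a space `L` of random variables are used as functions on `Ω`, through a chosen
representative of the equivalence class. -/
noncomputable instance : CoeFun L fun _ => Ω → ℝ := ⟨fun X => (X : Ω →ₘ[P] ℝ)⟩

theorem coeFn_le {X Y : L} : (X : Ω → ℝ) ≤ᵐ[P] Y ↔ X ≤ Y :=
  AEEqFun.coeFn_le

theorem coeFn_zero : ((0 : L) : Ω → ℝ) =ᵐ[P] 0 :=
  AEEqFun.coeFn_zero

theorem coeFn_add (X Y : L) : ((X + Y : L) : Ω → ℝ) =ᵐ[P] (X : Ω → ℝ) + (Y : Ω → ℝ) :=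
  AEEqFun.coeFn_add _ _

theorem coeFn_sub (X Y : L) : ((X - Y : L) : Ω → ℝ) =ᵐ[P] (X : Ω → ℝ) - (Y : Ω → ℝ) :=
  AEEqFun.coeFn_sub _ _

theorem coeFn_neg (X : L) : ((-X : L) : Ω → ℝ) =ᵐ[P] -(X : Ω → ℝ) :=
  AEEqFun.coeFn_neg _

theorem coeFn_smul (c : ℝ) (X : L) : ((c • X : L) : Ω → ℝ) =ᵐ[P] c • (X : Ω → ℝ) :=
  AEEqFun.coeFn_smul _ _

theorem coeFn_nonneg {X : L} : (∀ᵐ ω ∂P, 0 ≤ X ω) ↔ 0 ≤ X := by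
  rw [← coeFn_le]
  refine eventually_congr ?_
  filter_upwards [coeFn_zero (L := L)] with ω h
  rw [h, Pi.zero_apply]

theorem sub_smul_le (X : L) {Y : L} (hY : 0 ≤ Y) {c : ℝ} (hc : 0 ≤ c) : X - c • Y ≤ X := by
  refine coeFn_le.1 ?_
  filter_upwards [coeFn_sub X (c • Y), coeFn_smul c Y, coeFn_nonneg.2 hY] with ω hsub hsmul hYω
  rw [hsub, Pi.sub_apply, hsmul]
  exact sub_le_self _ (mul_nonneg hc hYω)

theorem HasIndicators.mono (h1 : HasIndicators mΩ le_rfl L) (hG : G ≤ mΩ) :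
    HasIndicators G hG L :=
  fun X hX A hA => h1 X hX A (hG A hA)

theorem coeFn_restr (X : Ω →ₘ[P] ℝ) {A : Set Ω} (hA : MeasurableSet A) :
    restr X A hA =ᵐ[P] A.indicator X :=
  AEEqFun.coeFn_mk _ _

theorem restr_add (X Y : Ω →ₘ[P] ℝ) {A : Set Ω} (hA : MeasurableSet A) :
    restr (X + Y) A hA = restr X A hA + restr Y A hA := by
  refine AEEqFun.ext ?_
  filter_upwards [coeFn_restr (X + Y) hA, coeFn_restr X hA, coeFn_restr Y hA,
    AEEqFun.coeFn_add X Y, AEEqFun.coeFn_add (restr X A hA) (restr Y A hA)]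
    with ω hXY hX hY hadd hadd'
  by_cases hω : ω ∈ A <;> simp [hXY, hX, hY, hadd, hadd', hω]

theorem restr_smul (c : ℝ) (X : Ω →ₘ[P] ℝ) {A : Set Ω} (hA : MeasurableSet A) :
    restr (c • X) A hA = c • restr X A hA := by
  refine AEEqFun.ext ?_
  filter_upwards [coeFn_restr (c • X) hA, coeFn_restr X hA, AEEqFun.coeFn_smul c X,
    AEEqFun.coeFn_smul c (restr X A hA)] with ω hcX hX hsmul hsmul'
  by_cases hω : ω ∈ A <;> simp [hcX, hX, hsmul, hsmul', hω]

/-- The map `X ↦ X 𝟏_A` on a space with property `1_G`, as a linear map: composition with it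
localizes a functional to the event `A`. -/
noncomputable def indicatorMap (h1 : HasIndicators G hG L) {A : Set Ω} (hA : MeasurableSet[G] A) :
    L →ₗ[ℝ] L where
  toFun X := ⟨restr X A (hG A hA), h1 X X.2 A hA⟩
  map_add' X Y := Subtype.ext (restr_add X.1 Y.1 (hG A hA))
  map_smul' c X := Subtype.ext (restr_smul c X.1 (hG A hA))

theorem coeFn_indicatorMap (h1 : HasIndicators G hG L) {A : Set Ω} (hA : MeasurableSet[G] A)
    (X : L) : (indicatorMap h1 hA X : Ω → ℝ) =ᵐ[P] A.indicator X :=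
  coeFn_restr _ (hG A hA)

theorem comp_indicatorMap_mem_orderDual (h1 : HasIndicators G hG L) {A : Set Ω}
    (hA : MeasurableSet[G] A) {φ : L →ₗ[ℝ] ℝ} (hφ : φ ∈ orderDual L) :
    φ ∘ₗ indicatorMap h1 hA ∈ orderDual L := by
  intro ι _ _ _ x a ⟨y, hy, hy0, hxy⟩
  refine hφ ι _ _ ⟨y, hy, hy0, fun i => le_trans ?_ (hxy i)⟩
  rw [← Submodule.coe_sub, ← Submodule.coe_sub, ← map_sub, ← AEEqFun.coeFn_le]
  filter_upwards [coeFn_indicatorMap h1 hA (x i - a), AEEqFun.coeFn_abs (x i - a).1,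
    AEEqFun.coeFn_abs (indicatorMap h1 hA (x i - a)).1] with ω hind habs habs'
  rw [habs, habs', hind]
  exact norm_indicator_le_norm_self (E := ℝ) _ _

/-- The pasting `X 𝟏_E + Y 𝟏_{Eᶜ}` of two random variables along an event `E ∈ G`, the operation
that (REG) is about. -/
noncomputable def glue (h1 : HasIndicators G hG L) {E : Set Ω} (hE : MeasurableSet[G] E)
    (X Y : L) : L :=
  indicatorMap h1 hE X + indicatorMap h1 hE.compl Y

theorem coeFn_glue (h1 : HasIndicators G hG L) {E : Set Ω} (hE : MeasurableSet[G] E) (X Y : L) :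
    (glue h1 hE X Y : Ω → ℝ) =ᵐ[P] E.indicator X + Eᶜ.indicator Y :=
  (coeFn_add _ _).trans ((coeFn_indicatorMap h1 hE X).add (coeFn_indicatorMap h1 hE.compl Y))

variable {φ ψ : L →ₗ[ℝ] ℝ} {Z W : Ω → ℝ}

theorem Represents.congr (hZ : Represents Z φ) (hZW : Z =ᵐ[P] W) : Represents W φ := by
  refine ⟨hZ.1.congr hZW, fun X => ?_⟩
  have hmul : (fun ω => Z ω * X ω) =ᵐ[P] fun ω => W ω * X ω := hZW.mul (ae_eq_refl _)
  exact ⟨(hZ.2 X).1.congr hmul, (hZ.2 X).2.trans (integral_congr_ae hmul)⟩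

theorem Represents.smul (hZ : Represents Z φ) (c : ℝ) : Represents (c • Z) (c • φ) := by
  refine ⟨hZ.1.smul c, fun X => ?_⟩
  simp only [Pi.smul_apply, smul_eq_mul, mul_assoc, LinearMap.smul_apply]
  exact ⟨(hZ.2 X).1.const_mul c, by rw [(hZ.2 X).2, integral_const_mul]⟩

theorem Represents.sub (hZ : Represents Z φ) (hW : Represents W ψ) :
    Represents (Z - W) (φ - ψ) := by
  refine ⟨hZ.1.sub hW.1, fun X => ?_⟩
  simp only [Pi.sub_apply, sub_mul, LinearMap.sub_apply]
  exact ⟨(hZ.2 X).1.sub (hW.2 X).1, by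
    rw [(hZ.2 X).2, (hW.2 X).2, integral_sub (hZ.2 X).1 (hW.2 X).1]⟩

theorem Represents.indicator (h1 : HasIndicators G hG L) {A : Set Ω} (hA : MeasurableSet[G] A)
    (hZ : Represents Z φ) : Represents (A.indicator Z) (φ ∘ₗ indicatorMap h1 hA) := by
  refine ⟨hZ.1.indicator (hG A hA), fun X => ?_⟩
  have hmul : (fun ω => Z ω * indicatorMap h1 hA X ω) =ᵐ[P] fun ω => A.indicator Z ω * X ω := by
    filter_upwards [coeFn_indicatorMap h1 hA X] with ω hω
    rw [hω, ← Set.indicator_mul_left, ← Set.indicator_mul_right]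
  obtain ⟨hint, heq⟩ := hZ.2 (indicatorMap h1 hA X)
  exact ⟨hint.congr hmul, heq.trans (integral_congr_ae hmul)⟩

theorem Represents.setIntegral_mul_sub_nonpos (hZ : Represents Z φ) {D E : Set Ω} {c : ℝ}
    (hc : 0 < c) (hW : W =ᵐ[P] c • D.indicator Z) (hED : E ⊆ D) (hE : MeasurableSet E) {X Y : L}
    (hle : ∫ ω in E, W ω * X ω ∂P ≤ ∫ ω in E, W ω * Y ω ∂P) :
    ∫ ω in E, Z ω * (X - Y : L) ω ∂P ≤ 0 := by
  have hscale : ∀ V : L, ∫ ω in E, W ω * V ω ∂P = c * ∫ ω in E, Z ω * V ω ∂P := fun V => by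
    rw [← integral_const_mul]
    refine setIntegral_congr_ae hE ?_
    filter_upwards [hW] with ω hω hωE
    rw [hω, Pi.smul_apply, Set.indicator_of_mem (hED hωE), smul_eq_mul, mul_assoc]
  rw [hscale, hscale] at hle
  have hsub : ∫ ω in E, Z ω * (X - Y : L) ω ∂P =
      ∫ ω in E, Z ω * X ω ∂P - ∫ ω in E, Z ω * Y ω ∂P := by
    rw [← integral_sub (hZ.2 X).1.integrableOn (hZ.2 Y).1.integrableOn]
    refine setIntegral_congr_ae hE ?_
    filter_upwards [coeFn_sub X Y] with ω hω _
    rw [hω, Pi.sub_apply, mul_sub]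
  rw [hsub]
  exact sub_nonpos.2 (le_of_mul_le_mul_left hle hc)

theorem Represents.ae_nonneg_of_pos (h1 : HasIndicators mΩ le_rfl L) (hZ : Represents Z φ)
    (hZm : Measurable Z) (hφ : ∀ X, 0 ≤ X → 0 ≤ φ X) (X : L) :
    ∀ᵐ ω ∂P, 0 < X ω → 0 ≤ Z ω := by
  have hN : MeasurableSet {ω | Z ω < 0 ∧ 0 < X ω} :=
    (hZm measurableSet_Iio).inter (X.1.measurable measurableSet_Ioi)
  set N := {ω | Z ω < 0 ∧ 0 < X ω}
  have hX_nonneg : 0 ≤ indicatorMap h1 hN X := by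
    refine coeFn_nonneg.1 ?_
    filter_upwards [coeFn_indicatorMap h1 hN X] with ω hω
    rw [hω]
    exact Set.indicator_nonneg (fun ω hω => hω.2.le) ω
  obtain ⟨hint, heq⟩ := (hZ.indicator h1 hN).2 X
  have hle : ∀ ω, 0 ≤ -(N.indicator Z ω * X ω) := fun ω => by
    by_cases hω : ω ∈ N
    · simpa [hω] using mul_nonpos_of_nonpos_of_nonneg hω.1.le hω.2.le
    · simp [hω]
  have hzero : ∫ ω, -(N.indicator Z ω * X ω) ∂P = 0 := by
    refine le_antisymm ?_ (integral_nonneg hle)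
    rw [integral_neg, ← heq]
    exact neg_nonpos.2 (hφ _ hX_nonneg)
  filter_upwards [(integral_eq_zero_iff_of_nonneg hle hint.neg).1 hzero] with ω hω hXω
  by_contra! hZω
  have hmem : ω ∈ N := ⟨hZω, hXω⟩
  simp [hmem, hZω.ne, hXω.ne'] at hω

theorem Represents.exists_nonneg (h1 : HasIndicators mΩ le_rfl L) (hZ : Represents Z φ)
    (hφ : ∀ X, 0 ≤ X → 0 ≤ φ X) : ∃ W : Ω → ℝ, 0 ≤ W ∧ Represents W φ := by
  obtain ⟨Z', hZ'm, hZZ'⟩ := hZ.1.aestronglyMeasurable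
  have hZ' := hZ.congr hZZ'
  refine ⟨fun ω => max (Z' ω) 0, fun ω => le_max_right _ _, hZ'.1.pos_part, fun X => ?_⟩
  have hmul : (fun ω => Z' ω * X ω) =ᵐ[P] fun ω => max (Z' ω) 0 * X ω := by
    filter_upwards [hZ'.ae_nonneg_of_pos h1 hZ'm.measurable hφ X,
      hZ'.ae_nonneg_of_pos h1 hZ'm.measurable hφ (-X), coeFn_neg X] with ω hpos hneg hnegX
    rw [hnegX, Pi.neg_apply, neg_pos] at hneg
    rcases lt_trichotomy (X ω) 0 with hX | hX | hX
    · rw [max_eq_left (hneg hX)]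
    · simp only [hX, mul_zero]
    · rw [max_eq_left (hpos hX)]
  exact ⟨(hZ'.2 X).1.congr hmul, (hZ'.2 X).2.trans (integral_congr_ae hmul)⟩

end Functionals

section DualProbabilities

variable {Ω : Type u} {G mΩ : MeasurableSpace Ω} {P : Measure Ω} {L : Submodule ℝ (Ω →ₘ[P] ℝ)}

theorem Represents.exists_dualProbability [SigmaFinite P] {φ : L →ₗ[ℝ] ℝ} {Z : Ω → ℝ}
    (hZ : Represents Z φ) (hφ : φ ∈ orderDual L) (hZ_nonneg : 0 ≤ Z) (hZ_pos : 0 < ∫ ω, Z ω ∂P) :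
    ∃ Q ∈ dualProbabilities L,
      (fun ω => (Q.rnDeriv P ω).toReal) =ᵐ[P] (∫ ω, Z ω ∂P)⁻¹ • Z := by
  set c := (∫ ω, Z ω ∂P)⁻¹
  have hcZ := hZ.smul c
  have hcZ_nonneg : 0 ≤ c • Z := smul_nonneg (inv_nonneg.2 hZ_pos.le) hZ_nonneg
  let Q := P.withDensity fun ω => ENNReal.ofReal ((c • Z) ω)
  have hQ : IsProbabilityMeasure Q := ⟨by
    rw [withDensity_apply _ MeasurableSet.univ, Measure.restrict_univ,
      ← ofReal_integral_eq_lintegral_ofReal hcZ.1 (Eventually.of_forall hcZ_nonneg)]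
    simp only [Pi.smul_apply, smul_eq_mul]
    rw [integral_const_mul, inv_mul_cancel₀ hZ_pos.ne', ENNReal.ofReal_one]⟩
  have hdensity : (fun ω => (Q.rnDeriv P ω).toReal) =ᵐ[P] c • Z := by
    filter_upwards [Measure.rnDeriv_withDensity₀ P
      hcZ.1.aestronglyMeasurable.aemeasurable.ennreal_ofReal] with ω hω
    rw [hω, ENNReal.toReal_ofReal (hcZ_nonneg ω)]
  exact ⟨Q, ⟨hQ, withDensity_absolutelyContinuous _ _, c • φ, Submodule.smul_mem _ _ hφ,
    hcZ.congr hdensity.symm⟩, hdensity⟩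

theorem setIntegral_rnDeriv_mul_le_of_condExp_le [SigmaFinite P] (hG : G ≤ mΩ) {Q : Measure Ω}
    (hQ : Q ∈ dualProbabilities L) {X Y : L}
    (hXY : Q[(X : Ω → ℝ) | G] ≤ᵐ[Q] Q[(Y : Ω → ℝ) | G]) {E : Set Ω} (hE : MeasurableSet[G] E) :
    ∫ ω in E, (Q.rnDeriv P ω).toReal * X ω ∂P ≤ ∫ ω in E, (Q.rnDeriv P ω).toReal * Y ω ∂P := by
  obtain ⟨hQprob, hQP, φ, -, hφ⟩ := hQ
  have hint : ∀ W : L, Integrable W Q := fun W =>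
    (integrable_toReal_rnDeriv_mul_iff hQP).1 (hφ.2 W).1
  rw [setIntegral_toReal_rnDeriv_mul hQP (hG _ hE), setIntegral_toReal_rnDeriv_mul hQP (hG _ hE)]
  exact setIntegral_le_of_condExp_le hG (hint X) (hint Y) hXY hE

/- If `Z` represents `φ`, then `|Z|` represents `φ(· 𝟏_{Z ≥ 0}) - φ(· 𝟏_{Z < 0})`. -/
theorem Represents.exists_abs (h1 : HasIndicators mΩ le_rfl L) {φ : L →ₗ[ℝ] ℝ} {Z : Ω → ℝ}
    (hZ : Represents Z φ) (hφ : φ ∈ orderDual L) : ∃ ψ ∈ orderDual L, Represents |Z| ψ := by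
  obtain ⟨Z', hZ'm, hZZ'⟩ := hZ.1.aestronglyMeasurable
  have hA : MeasurableSet {ω | 0 ≤ Z' ω} := hZ'm.measurable measurableSet_Ici
  refine ⟨φ ∘ₗ indicatorMap h1 hA - φ ∘ₗ indicatorMap h1 hA.compl,
    sub_mem (comp_indicatorMap_mem_orderDual h1 hA hφ)
      (comp_indicatorMap_mem_orderDual h1 hA.compl hφ),
    ((hZ.indicator h1 hA).sub (hZ.indicator h1 hA.compl)).congr ?_⟩
  filter_upwards [hZZ'] with ω hω
  rcases le_or_gt 0 (Z' ω) with h | h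
  · simp [hω, h, abs_of_nonneg]
  · simp [hω, h, abs_of_neg]

theorem represents_one_zero_of_subsingleton [IsFiniteMeasure P] [Subsingleton L] :
    Represents (1 : Ω → ℝ) (0 : L →ₗ[ℝ] ℝ) := by
  refine ⟨integrable_const 1, fun X => ?_⟩
  have hX : (fun ω => (1 : Ω → ℝ) ω * X ω) =ᵐ[P] 0 := by
    filter_upwards [coeFn_zero (L := L)] with ω hω
    rw [Subsingleton.elim X 0, hω, Pi.zero_apply, mul_zero]
  exact ⟨(integrable_zero Ω ℝ P).congr hX.symm, by
    rw [integral_congr_ae hX, LinearMap.zero_apply, Pi.zero_def, integral_zero]⟩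

theorem dualProbabilities_nonempty [IsFiniteMeasure P] [NeZero P] (h1 : HasIndicators mΩ le_rfl L)
    (hdual : DualInL1 L) (hsep : DualSeparates L) : (dualProbabilities L).Nonempty := by
  rcases subsingleton_or_nontrivial L with _ | _
  · obtain ⟨Q, hQ, -⟩ := (represents_one_zero_of_subsingleton (L := L)).exists_dualProbability
      (zero_mem _) zero_le_one (by simp [measureReal_def, ENNReal.toReal_pos_iff, NeZero.ne])
    exact ⟨Q, hQ⟩
  · obtain ⟨X, hX⟩ := exists_ne (0 : L)
    obtain ⟨φ, hφ, hφX⟩ := hsep X hX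
    obtain ⟨Z, hZ⟩ := hdual φ hφ
    obtain ⟨ψ, hψ, hZψ⟩ := hZ.exists_abs h1 hφ
    have hpos : 0 < ∫ ω, |Z| ω ∂P := by
      refine (integral_nonneg fun ω => abs_nonneg _).lt_of_ne fun h0 => hφX ?_
      have hZ0 := (integral_eq_zero_iff_of_nonneg (fun ω => abs_nonneg (Z ω)) hZ.1.abs).1 h0.symm
      rw [(hZ.2 X).2]
      refine integral_eq_zero_of_ae ?_
      filter_upwards [hZ0] with ω hω
      simp [abs_eq_zero.1 hω]
    obtain ⟨Q, hQ, -⟩ := hZψ.exists_dualProbability hψ (abs_nonneg Z) hpos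
    exact ⟨Q, hQ⟩

end DualProbabilities

section Separation

variable {Ω : Type u} {G mΩ : MeasurableSpace Ω} {P : Measure Ω}
  {L LF LG : Submodule ℝ (Ω →ₘ[P] ℝ)} {π : LF → LG}

theorem exists_orderDual_separating {C : Set L} (hconv : Convex ℝ C)
    (hclosed : IsClosed[weakTopology L] C) {x : L} (hx : x ∉ C) :
    ∃ φ ∈ orderDual L, ∃ r : ℝ, (∀ a ∈ C, φ a < r) ∧ r < φ x := by
  let T : L →ₗ[ℝ] (orderDual L → ℝ) := LinearMap.pi fun φ => (φ : L →ₗ[ℝ] ℝ)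
  let _ : TopologicalSpace L := weakTopology L
  have : IsTopologicalAddGroup L := topologicalAddGroup_induced T
  have : ContinuousSMul ℝ L := continuousSMul_induced T
  have : LocallyConvexSpace ℝ L := LocallyConvexSpace.induced T
  obtain ⟨f, r, hf, hr⟩ := geometric_hahn_banach_closed_point hconv hclosed hx
  refine ⟨f.toLinearMap, fun ι _ _ _ y a hya => ?_, r, hf, hr⟩
  refine (f.continuous.tendsto a).comp ?_
  rw [nhds_induced, tendsto_comap_iff, tendsto_pi_nhds]
  exact fun φ => φ.2 ι y a hya

theorem nonneg_of_forall_sub_natCast_smul_lt {E : Type*} [AddCommGroup E] [Module ℝ E]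
    {φ : E →ₗ[ℝ] ℝ} {x y : E} {r : ℝ} (h : ∀ n : ℕ, φ (x - (n : ℝ) • y) < r) : 0 ≤ φ y := by
  by_contra! hneg
  obtain ⟨n, hn⟩ := exists_nat_gt ((r - φ x) / -φ y)
  have hlt := h n
  rw [map_sub, map_smul, smul_eq_mul] at hlt
  rw [div_lt_iff₀ (neg_pos.2 hneg)] at hn
  linarith

theorem CondQuasiconvex.quasiconvexOn (hqco : CondQuasiconvex G π) :
    QuasiconvexOn ℝ Set.univ π := by
  rintro Y ξ ⟨-, hξ⟩ η ⟨-, hη⟩ a b ha hb hab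
  have hconst : ((AEEqFun.const Ω a : Ω →ₘ[P] ℝ) : Ω → ℝ) =ᵐ[P] Function.const Ω a :=
    AEEqFun.coeFn_const Ω a
  refine ⟨Set.mem_univ _, le_trans (α := Ω →ₘ[P] ℝ) (hqco ξ η _ (AEEqFun.const Ω a)
    (aestronglyMeasurable_const.congr hconst.symm) ?_ ?_ ?_) (sup_le hξ hη)⟩
  · refine AEEqFun.coeFn_le.1 ?_
    filter_upwards [hconst, AEEqFun.coeFn_zero (β := ℝ)] with ω hω hzero
    simpa [hω, hzero] using ha
  · refine AEEqFun.coeFn_le.1 ?_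
    filter_upwards [hconst, AEEqFun.coeFn_one (β := ℝ)] with ω hω hone
    simp only [hω, hone, Function.const_apply, Pi.one_apply]
    linarith
  · refine AEEqFun.ext ?_
    filter_upwards [hconst, AEEqFun.coeFn_one (β := ℝ), coeFn_add (a • ξ) (b • η), coeFn_smul a ξ,
      coeFn_smul b η, AEEqFun.coeFn_add (AEEqFun.const Ω a * ξ.1) ((1 - AEEqFun.const Ω a) * η.1),
      AEEqFun.coeFn_mul (AEEqFun.const Ω a) ξ.1, AEEqFun.coeFn_mul (1 - AEEqFun.const Ω a) η.1,
      AEEqFun.coeFn_sub 1 (AEEqFun.const Ω a)] with ω hω hone hadd hξ hη hadd' hmul hmul' hsub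
    rw [hadd, hadd', Pi.add_apply, Pi.add_apply, hξ, hη, hmul, hmul', Pi.mul_apply, Pi.mul_apply,
      hsub, Pi.sub_apply, hω, hone]
    simp [← hab]

/- A functional that separates `X` from the sublevel set of a monotone map is positive, since the
sublevel set contains `ξ₀ - n η` for all `η ≥ 0` and all `n`. -/
theorem exists_represents_nonneg_separating (h1F : HasIndicators mΩ le_rfl LF)
    (hdual : DualInL1 LF) (hmon : Monotone π) (hqc : QuasiconvexOn ℝ Set.univ π)
    (hlsc : WeaklyLSC π) {X ξ₀ : LF} {Y : LG} (hξ₀ : π ξ₀ ≤ Y) (hX : ¬ π X ≤ Y) :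
    ∃ φ ∈ orderDual LF, ∃ Z : Ω → ℝ, 0 ≤ Z ∧ Represents Z φ ∧
      ∃ ε > 0, ∀ ξ, π ξ ≤ Y → ε ≤ φ (X - ξ) := by
  have hconv : Convex ℝ {ξ | π ξ ≤ Y} := by simpa using hqc Y
  obtain ⟨φ, hφ, r, hφC, hφX⟩ := exists_orderDual_separating hconv (hlsc Y) hX
  have hφ_nonneg : ∀ η, 0 ≤ η → 0 ≤ φ η := fun η hη =>
    nonneg_of_forall_sub_natCast_smul_lt fun n =>
      hφC _ ((hmon (sub_smul_le ξ₀ hη n.cast_nonneg)).trans hξ₀)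
  obtain ⟨Z₀, hZ₀⟩ := hdual φ hφ
  obtain ⟨Z, hZ_nonneg, hZ⟩ := hZ₀.exists_nonneg h1F hφ_nonneg
  refine ⟨φ, hφ, Z, hZ_nonneg, hZ, φ X - r, sub_pos.2 hφX, fun ξ hξ => ?_⟩
  rw [map_sub]
  exact sub_le_sub_left (hφC ξ hξ).le _

end Separation

section Localization

variable {Ω : Type u} {G mΩ : MeasurableSpace Ω} {hG : G ≤ mΩ} {P : Measure Ω}
  {LF LG : Submodule ℝ (Ω →ₘ[P] ℝ)} {π : LF → LG}

theorem Regular.map_glue_le (hreg : Regular G hG π) (h1 : HasIndicators G hG LF) {E : Set Ω}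
    (hE : MeasurableSet[G] E) {ξ η : LF} {Y : LG} (hξ : ∀ᵐ ω ∂P, ω ∈ E → π ξ ω ≤ Y ω)
    (hη : ∀ᵐ ω ∂P, ω ∉ E → π η ω ≤ Y ω) : π (glue h1 hE ξ η) ≤ Y := by
  refine coeFn_le.1 ?_
  rw [hreg ξ η (glue h1 hE ξ η) E hE rfl]
  filter_upwards [AEEqFun.coeFn_add (restr (π ξ).1 E (hG _ hE)) (restr (π η).1 Eᶜ (hG _ hE).compl),
    coeFn_restr (π ξ).1 (hG _ hE), coeFn_restr (π η).1 (hG _ hE).compl, hξ, hη]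
    with ω hadd hξE hηE hξω hηω
  rw [hadd, Pi.add_apply, hξE, hηE]
  by_cases hω : ω ∈ E
  · simpa [hω] using hξω hω
  · simpa [hω] using hηω hω

theorem mul_sub_glue_ae_eq (h1 : HasIndicators G hG LF) {E : Set Ω} (hE : MeasurableSet[G] E)
    (Z : Ω → ℝ) (X ξ η : LF) :
    (fun ω => Z ω * (X - glue h1 hE ξ η : LF) ω) =ᵐ[P]
      E.indicator (fun ω => Z ω * (X - ξ : LF) ω) +
        Eᶜ.indicator (fun ω => Z ω * (X - η : LF) ω) := by
  filter_upwards [coeFn_sub X (glue h1 hE ξ η), coeFn_glue h1 hE ξ η, coeFn_sub X ξ,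
    coeFn_sub X η] with ω hsub hglue hξ hη
  by_cases hω : ω ∈ E
  · simp only [Pi.add_apply, Pi.sub_apply, hsub, hglue, hξ, Set.indicator_of_mem hω,
      Set.indicator_of_notMem (Set.notMem_compl_iff.2 hω), add_zero]
  · simp only [Pi.add_apply, Pi.sub_apply, hsub, hglue, hη,
      Set.indicator_of_notMem hω, Set.indicator_of_mem (Set.mem_compl hω), zero_add]

variable [IsFiniteMeasure P] {X ξ₀ : LF} {Y : LG} {φ : LF →ₗ[ℝ] ℝ} {Z : Ω → ℝ}

theorem Regular.exists_measurableSet_forall_condExp_mul_sub_pos (hreg : Regular G hG π)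
    (h1 : HasIndicators G hG LF) (hξ₀ : π ξ₀ ≤ Y) (hZ : Represents Z φ) {ε : ℝ} (hε : 0 < ε)
    (hφ : ∀ ξ, π ξ ≤ Y → ε ≤ φ (X - ξ)) :
    ∃ D, MeasurableSet[G] D ∧ P D ≠ 0 ∧
      ∀ ξ, π ξ ≤ Y → ∀ᵐ ω ∂P, ω ∈ D → 0 < P[fun ω => Z ω * (X - ξ : LF) ω | G] ω := by
  have : Nonempty {ξ // π ξ ≤ Y} := ⟨ξ₀, hξ₀⟩
  obtain ⟨D, hD, hD0, hpos⟩ := exists_measurableSet_forall_condExp_pos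
    (h := fun (ξ : {ξ // π ξ ≤ Y}) ω => Z ω * (X - ξ : LF) ω) hG (fun ξ => (hZ.2 _).1)
    (fun E hE ξ η => ⟨⟨glue h1 hE ξ η, hreg.map_glue_le h1 hE
      ((coeFn_le.2 ξ.2).mono fun ω hω _ => hω) ((coeFn_le.2 η.2).mono fun ω hω _ => hω)⟩,
      mul_sub_glue_ae_eq h1 hE Z X ξ η⟩) hε
    (fun ξ => (hφ ξ ξ.2).trans_eq (hZ.2 _).2)
  exact ⟨D, hD, hD0, fun ξ hξ => hpos ⟨ξ, hξ⟩⟩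

/- Otherwise `ξ` lies in the sublevel set on some `E ⊆ D`, and so does `ξ` glued on `E` with `ξ₀`,
although `Z (X - ξ)` has nonpositive integral over `E`. -/
theorem Regular.ae_lt_map_of_forall_setIntegral_nonpos (hreg : Regular G hG π)
    (h1 : HasIndicators G hG LF) (hLGmeas : ∀ Y ∈ LG, AEStronglyMeasurable[G] Y P)
    (hξ₀ : π ξ₀ ≤ Y) (hZ : Represents Z φ) {D : Set Ω} (hD : MeasurableSet[G] D)
    (hpos : ∀ ξ, π ξ ≤ Y → ∀ᵐ ω ∂P, ω ∈ D → 0 < P[fun ω => Z ω * (X - ξ : LF) ω | G] ω) {ξ : LF}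
    (hξ : ∀ E ⊆ D, MeasurableSet[G] E → ∫ ω in E, Z ω * (X - ξ : LF) ω ∂P ≤ 0) :
    ∀ᵐ ω ∂P, ω ∈ D → Y ω < π ξ ω := by
  obtain ⟨T, hT, hTle⟩ :=
    exists_measurableSet_ae_mem_iff_le (hLGmeas _ (π ξ).2) (hLGmeas _ Y.2)
  have hE : MeasurableSet[G] (D ∩ T) := hD.inter hT
  have hglue : π (glue h1 hE ξ ξ₀) ≤ Y := hreg.map_glue_le h1 hE
    (hTle.mono fun ω hω hωE => hω.1 hωE.2) ((coeFn_le.2 hξ₀).mono fun ω hω _ => hω)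
  have hnull : P (D ∩ T) = 0 := by
    refine measure_eq_zero_of_condExp_pos_of_setIntegral_nonpos hG (hZ.2 _).1 hE
      ((hpos _ hglue).mono fun ω hω hωE => hω hωE.1) ?_
    refine (setIntegral_congr_ae (hG _ hE) ?_).trans_le (hξ _ Set.inter_subset_left hE)
    filter_upwards [mul_sub_glue_ae_eq h1 hE Z X ξ ξ₀] with ω hω hωE
    refine hω.trans ?_
    simp [hωE.1, hωE.2]
  filter_upwards [measure_eq_zero_iff_ae_notMem.1 hnull, hTle] with ω hω hle hωD
  exact not_le.1 fun h => hω ⟨hωD, hle.2 h⟩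

theorem exists_dualProbability_forall_ae_lt_map (hreg : Regular G hG π)
    (hLGmeas : ∀ Y ∈ LG, AEStronglyMeasurable[G] Y P) (h1F : HasIndicators mΩ le_rfl LF)
    (hdual : DualInL1 LF) (hmon : Monotone π) (hqc : QuasiconvexOn ℝ Set.univ π)
    (hlsc : WeaklyLSC π) (hξ₀ : π ξ₀ ≤ Y) (hX : ¬ π X ≤ Y) :
    ∃ Q ∈ dualProbabilities LF, ∃ D, MeasurableSet[G] D ∧ P D ≠ 0 ∧
      ∀ ξ : LF, Q[(X : Ω → ℝ) | G] ≤ᵐ[Q] Q[(ξ : Ω → ℝ) | G] →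
        ∀ᵐ ω ∂P, ω ∈ D → Y ω < π ξ ω := by
  have h1 := h1F.mono hG
  obtain ⟨φ, hφ, Z, hZ_nonneg, hZ, ε, hε, hφε⟩ :=
    exists_represents_nonneg_separating h1F hdual hmon hqc hlsc hξ₀ hX
  obtain ⟨D, hD, hD0, hpos⟩ :=
    hreg.exists_measurableSet_forall_condExp_mul_sub_pos h1 hξ₀ hZ hε hφε
  have hDZ_nonneg : 0 ≤ D.indicator Z := Set.indicator_nonneg fun ω _ => hZ_nonneg ω
  have hDZ_pos : 0 < ∫ ω, D.indicator Z ω ∂P :=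
    integral_indicator_pos_of_condExp_mul_pos hG hZ.1 hZ_nonneg (hZ.2 _).1 hD hD0 (hpos ξ₀ hξ₀)
  obtain ⟨Q, hQ, hdensity⟩ := (hZ.indicator h1 hD).exists_dualProbability
    (comp_indicatorMap_mem_orderDual h1 hD hφ) hDZ_nonneg hDZ_pos
  exact ⟨Q, hQ, D, hD, hD0, fun ξ hξ =>
    hreg.ae_lt_map_of_forall_setIntegral_nonpos h1 hLGmeas hξ₀ hZ hD hpos fun E hED hE =>
      hZ.setIntegral_mul_sub_nonpos (inv_pos.2 hDZ_pos) hdensity hED (hG _ hE)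
        (setIntegral_rnDeriv_mul_le_of_condExp_le hG hQ hξ hE)⟩

end Localization


section Representation

variable {Ω : Type u} {G mΩ : MeasurableSpace Ω} {hG : G ≤ mΩ} {P : Measure Ω}
  {LF LG : Submodule ℝ (Ω →ₘ[P] ℝ)} {π : LF → LG} {X : LF}

theorem coeFn_toExt (X : Ω →ₘ[P] ℝ) : toExt X =ᵐ[P] fun ω => (X ω : EReal) :=
  AEEqFun.coeFn_comp _ continuous_coe_real_ereal X

variable [IsFiniteMeasure P]

theorem K_le (π : LF → LG) (X : LF) (Q : Measure Ω) : K G π X Q ≤ toExt (π X : Ω →ₘ[P] ℝ) :=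
  (isGLB_essInfFamily P _).1 ⟨X, EventuallyLE.refl _ _, rfl⟩

theorem ae_le_K {Q : Measure Ω} {D : Set Ω} (hD : MeasurableSet D) (V : LG)
    (h : ∀ ξ : LF, Q[(X : Ω → ℝ) | G] ≤ᵐ[Q] Q[(ξ : Ω → ℝ) | G] →
      ∀ᵐ ω ∂P, ω ∈ D → V ω ≤ π ξ ω) :
    ∀ᵐ ω ∂P, ω ∈ D → (V ω : EReal) ≤ K G π X Q ω := by
  classical
  have hm : AEStronglyMeasurable (D.piecewise (fun ω => (V ω : EReal)) fun _ => ⊥) P :=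
    (Measurable.piecewise hD (measurable_coe_real_ereal.comp V.1.measurable)
      measurable_const).aestronglyMeasurable
  have hle : AEEqFun.mk _ hm ≤ K G π X Q := by
    refine (isGLB_essInfFamily P _).2 ?_
    rintro _ ⟨ξ, hξ, rfl⟩
    refine AEEqFun.coeFn_le.1 ?_
    filter_upwards [AEEqFun.coeFn_mk _ hm, coeFn_toExt (π ξ).1, h ξ hξ] with ω hmk hext hVξ
    rw [hmk, hext]
    by_cases hω : ω ∈ D
    · simpa [hω] using hVξ hω
    · simp [hω]
  filter_upwards [AEEqFun.coeFn_le.2 hle, AEEqFun.coeFn_mk _ hm] with ω hKω hmk hω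
  rwa [hmk, Set.piecewise_eq_of_mem _ _ _ hω] at hKω

variable {S : Ω → EReal}

/- On a non-null `B ⊆ A` the hypothesis is applied to `V` glued on `B` with `π X`: the set `D` it
provides is contained in `B`. -/
theorem Regular.ae_coe_le_of_map_le_of_lt_map (hreg : Regular G hG π)
    (h1 : HasIndicators G hG LF) (h1G : HasIndicators G hG LG)
    (hS : ∀ (Y : LG) (ξ : LF), π ξ ≤ Y → ¬ π X ≤ Y → ∃ D, MeasurableSet[G] D ∧ P D ≠ 0 ∧
      ∀ᵐ ω ∂P, ω ∈ D → Y ω < π X ω ∧ (Y ω : EReal) ≤ S ω)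
    {ξ : LF} {V : LG} {A : Set Ω} (hA : MeasurableSet[G] A)
    (hξ : ∀ᵐ ω ∂P, ω ∈ A → π ξ ω ≤ V ω) (hV : ∀ᵐ ω ∂P, ω ∈ A → V ω < π X ω) :
    ∀ᵐ ω ∂P, ω ∈ A → (V ω : EReal) ≤ S ω := by
  refine ae_mem_imp_of_forall_exists_subset hG hA fun B hBA hB hB0 => ?_
  have hY_on : ∀ᵐ ω ∂P, ω ∈ B → glue h1G hB V (π X) ω = V ω := by
    filter_upwards [coeFn_glue h1G hB V (π X)] with ω hω hωB
    simp [hω, hωB]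
  have hY_off : ∀ᵐ ω ∂P, ω ∉ B → glue h1G hB V (π X) ω = π X ω := by
    filter_upwards [coeFn_glue h1G hB V (π X)] with ω hω hωB
    simp [hω, hωB]
  have hglue : π (glue h1 hB ξ X) ≤ glue h1G hB V (π X) := hreg.map_glue_le h1 hB
    (by filter_upwards [hξ, hY_on] with ω hω hY hωB using (hω (hBA hωB)).trans_eq (hY hωB).symm)
    (hY_off.mono fun ω hY hωB => (hY hωB).ge)
  have hX : ¬ π X ≤ glue h1G hB V (π X) := fun hle => hB0 <| measure_eq_zero_iff_ae_notMem.2 <| by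
    filter_upwards [coeFn_le.2 hle, hY_on, hV] with ω hω hY hVω hωB
    exact (hω.trans_eq (hY hωB)).not_gt (hVω (hBA hωB))
  obtain ⟨D, hD, hD0, hDS⟩ := hS _ _ hglue hX
  have hDB : ∀ᵐ ω ∂P, ω ∈ D → ω ∈ B := by
    filter_upwards [hDS, hY_off] with ω hω hY hωD
    exact by_contra fun hωB => (hω hωD).1.ne (hY hωB)
  refine ⟨D ∩ B, Set.inter_subset_right, hD.inter hB, fun h0 => hD0 ?_, ?_⟩
  · exact le_zero_iff.1 ((measure_mono_ae (hDB.mono fun ω h hω => ⟨hω, h hω⟩)).trans_eq h0)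
  · filter_upwards [hDS, hY_on] with ω hω hY hωDB
    exact hY hωDB.2 ▸ (hω hωDB.1).2

theorem Regular.ae_coe_map_le_of_map_lt (hreg : Regular G hG π)
    (hLGmeas : ∀ Y ∈ LG, AEStronglyMeasurable[G] Y P)
    (h1 : HasIndicators G hG LF) (h1G : HasIndicators G hG LG)
    (hS : ∀ (Y : LG) (ξ : LF), π ξ ≤ Y → ¬ π X ≤ Y → ∃ D, MeasurableSet[G] D ∧ P D ≠ 0 ∧
      ∀ᵐ ω ∂P, ω ∈ D → Y ω < π X ω ∧ (Y ω : EReal) ≤ S ω) (ξ : LF) :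
    ∀ᵐ ω ∂P, π ξ ω < π X ω → (π X ω : EReal) ≤ S ω := by
  obtain ⟨E, hE, hE_iff⟩ :=
    exists_measurableSet_ae_mem_iff_le (hLGmeas _ (π X).2) (hLGmeas _ (π ξ).2)
  let c : ℕ → ℝ := fun n => 1 / ((n : ℝ) + 1)
  have hc_pos : ∀ n, 0 < c n := fun n => Nat.one_div_pos_of_nat
  have hc_le : ∀ n, c n ≤ 1 := fun n => by
    simpa [c] using Nat.one_div_le_one_div (α := ℝ) n.zero_le
  let V : ℕ → LG := fun n => π X - c n • (π X - π ξ)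
  have hV : ∀ n, ∀ᵐ ω ∂P, V n ω = π X ω - c n * (π X ω - π ξ ω) := fun n => by
    filter_upwards [coeFn_sub (π X) (c n • (π X - π ξ)), coeFn_smul (c n) (π X - π ξ),
      coeFn_sub (π X) (π ξ)] with ω hsub hsmul hsub'
    rw [hsub, Pi.sub_apply, hsmul, Pi.smul_apply, hsub', Pi.sub_apply, smul_eq_mul]
  have hVS : ∀ n, ∀ᵐ ω ∂P, ω ∈ Eᶜ → (V n ω : EReal) ≤ S ω := fun n => by
    refine hreg.ae_coe_le_of_map_le_of_lt_map h1 h1G hS hE.compl (ξ := ξ) ?_ ?_ <;>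
      filter_upwards [hE_iff, hV n] with ω hω hVω hωE <;>
      have hpos := sub_pos.2 (not_le.1 (mt hω.2 hωE))
    · linarith [mul_le_of_le_one_left hpos.le (hc_le n)]
    · linarith [mul_pos (hc_pos n) hpos]
  filter_upwards [hE_iff, ae_all_iff.2 hV, ae_all_iff.2 hVS] with ω hω hVω hSω hlt
  have hlim : Tendsto (fun n => V n ω) atTop (𝓝 (π X ω)) := by
    simp only [hVω]
    simpa [c] using tendsto_const_nhds.sub
      ((tendsto_one_div_add_atTop_nhds_zero_nat (𝕜 := ℝ)).mul_const (π X ω - π ξ ω))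
  exact le_of_tendsto' ((continuous_coe_real_ereal.tendsto _).comp hlim) fun n =>
    hSω n (mt hω.1 hlt.not_ge)

end Representation

end QuasiconvexDual

open QuasiconvexDual in
theorem theorem1_general {Ω : Type u} (G : MeasurableSpace Ω) {mΩ : MeasurableSpace Ω}
    (P : Measure Ω) [IsFiniteMeasure P] (hG : G ≤ mΩ) (LF LG : Submodule ℝ (Ω →ₘ[P] ℝ))
    (hLGmeas : ∀ Y ∈ LG, AEStronglyMeasurable[G] Y P) (h1F : HasIndicators mΩ le_rfl LF)
    (h1G : HasIndicators G hG LG) (hdual : DualInL1 LF) (hne : (dualProbabilities LF).Nonempty)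
    (π : LF → LG) (hmon : Monotone π) (hqc : QuasiconvexOn ℝ Set.univ π)
    (hreg : Regular G hG π) (hlsc : WeaklyLSC π) (X : LF) :
    IsLUB {Y | ∃ Q ∈ dualProbabilities LF, Y = K G π X Q} (toExt (π X : Ω →ₘ[P] ℝ)) := by
  refine ⟨?_, fun S hS => ?_⟩
  · rintro _ ⟨Q, -, rfl⟩
    exact K_le π X Q
  have hKS : ∀ Q ∈ dualProbabilities LF, ∀ᵐ ω ∂P, K G π X Q ω ≤ S ω := fun Q hQ =>
    AEEqFun.coeFn_le.2 (hS ⟨Q, hQ, rfl⟩)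
  have hlt : ∀ ξ, ∀ᵐ ω ∂P, π ξ ω < π X ω → (π X ω : EReal) ≤ S ω := by
    refine hreg.ae_coe_map_le_of_map_lt hLGmeas (h1F.mono hG) h1G fun Y ξ hξ hX => ?_
    obtain ⟨Q, hQ, D, hD, hD0, hQD⟩ :=
      exists_dualProbability_forall_ae_lt_map hreg hLGmeas h1F hdual hmon hqc hlsc hξ hX
    have hK := ae_le_K (hG _ hD) Y fun η hη => (hQD η hη).mono fun ω hω hωD => (hω hωD).le
    refine ⟨D, hD, hD0, ?_⟩
    filter_upwards [hQD X EventuallyLE.rfl, hK, hKS Q hQ] with ω hlt hle hKω hω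
    exact ⟨hlt hω, (hle hω).trans hKω⟩
  obtain ⟨Q₀, hQ₀⟩ := hne
  have hN : MeasurableSet {ω | S ω < (π X ω : EReal)} :=
    measurableSet_lt S.measurable (measurable_coe_real_ereal.comp (π X).1.measurable)
  have hKN := ae_le_K (G := G) (Q := Q₀) (X := X) hN (π X) fun ξ _ =>
    (hlt ξ).mono fun ω hω hωN => not_lt.1 fun h => (hω h).not_gt hωN
  refine AEEqFun.coeFn_le.1 ?_
  filter_upwards [hKN, hKS Q₀ hQ₀, coeFn_toExt (π X).1] with ω hKω hSω hext
  rw [hext]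
  exact not_lt.1 fun h => ((hKω h).trans hSω).not_gt h

theorem theorem1 {Ω : Type u} (G : MeasurableSpace Ω) {mΩ : MeasurableSpace Ω} (P : MeasureTheory.Measure Ω)
    [MeasureTheory.IsProbabilityMeasure P] (hG : G ≤ mΩ)
    (LF LG : Submodule ℝ (Ω →ₘ[P] ℝ))
    (hLF : QuasiconvexDual.IsVectorLattice LF) (hLG : QuasiconvexDual.IsVectorLattice LG)
    (hLGmeas : ∀ Y ∈ LG, AEStronglyMeasurable[G] Y P)
    (h1F : QuasiconvexDual.HasIndicators mΩ le_rfl LF)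
    (h1G : QuasiconvexDual.HasIndicators G hG LG)
    (hdual : QuasiconvexDual.DualInL1 LF) (hsep : QuasiconvexDual.DualSeparates LF)
    (π : LF → LG) (hmon : Monotone π) (hqco : QuasiconvexDual.CondQuasiconvex G π)
    (hreg : QuasiconvexDual.Regular G hG π) (hlsc : QuasiconvexDual.WeaklyLSC π) (X : LF) :
    IsLUB {Y | ∃ Q ∈ QuasiconvexDual.dualProbabilities LF, Y = QuasiconvexDual.K G π X Q}
      (QuasiconvexDual.toExt (π X : Ω →ₘ[P] ℝ)) :=
  theorem1_general G P hG LF LG hLGmeas h1F h1G hdual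
    (QuasiconvexDual.dualProbabilities_nonempty h1F hdual hsep) π hmon hqco.quasiconvexOn hreg
    hlsc X
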